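/- Let $\widetilde{\mathcal{SV}}$ be the extended Schrödinger–Virasoro conformal algebra, i.e. the Lie conformal algebra over $\mathbb{C}$ that is free as a $\mathbb{C}[\partial]$-module with basis $L,N,Y,M$ and has the $\lambda$-brackets $$[L_\lambda L]=(\partial+2\lambda)L,\quad [L_\lambda Y]=(\partial+\tfrac32\lambda)Y,\quad [Y_\lambda Y]=(\partial+2\lambda)M,\quad [L_\lambda M]=(\partial+\lambda)M,$$ $$[L_\lambda N]=(\partial+\lambda)N,\quad [N_\lambda Y]=Y,\quad [N_\lambda M]=2M,$$ the remaining brackets of generators being zero or given by skew-symmetry $[a_\lambda b]=-[b_{-\lambda-\partial}a]$. Let $\langle M\rangle=\mathbb{C}[\partial]M$, which is an ideal. For a Lie conformal algebra $\mathcal{A}$ let $\tilde C^q(\mathcal{A},\mathbb{C})$ be the space of $q$-cochains with coefficients in the trivial module $\mathbb{C}$ (on which $\partial$ and $\mathcal{A}$ act by zero): $\mathbb{C}$-linear maps $\gamma:\mathcal{A}^{\otimes q}\to\mathbb{C}[\lambda_1,\dots,\lambda_q]$ with $\gamma_{\lambda_1,\dots,\lambda_q}(\dots,\partial a_i,\dots)=-\lambda_i\gamma_{\lambda_1,\dots,\lambda_q}(\dots,a_i,\dots)$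 that are skew-symmetric under simultaneous permutations of the $a_i$ and $\lambda_i$. The differential is $$(d\gamma)_{\lambda_1,\dots,\lambda_{q+1}}(a_1,\dots,a_{q+1})=\sum_{1\le i<j\le q+1}(-1)^{i+j}\gamma_{\lambda_i+\lambda_j,\lambda_1,\dots,\hat\lambda_i,\dots,\hat\lambda_j,\dots,\lambda_{q+1}}([a_{i\,\lambda_i}a_j],a_1,\dots,\hat a_i,\dots,\hat a_j,\dots,a_{q+1}),$$ and $\partial$ acts on $\tilde C^q(\mathcal{A},\mathbb{C})$ as multiplication by $\lambda_1+\dots+\lambda_q$; it commutes with $d$. The basic cohomology $\tilde{\mathrm H}^q(\mathcal{A},\mathbb{C})$, a $\mathbb{C}[\partial]$-module, is the cohomology of $(\tilde C^\bullet,d)$, and the reduced cohomology $\mathrm H^q(\mathcal{A},\mathbb{C})$, a complex vector space, is the cohomology of the quotient complex $\tilde C^\bullet/\partial\tilde C^\bullet$. Then the quotient Lie conformal algebra $\widetilde{\mathcal{SV}}/\langle M\rangle$ is free of rank $3$ over $\mathbb{C}[\partial]$, and for every integer $q\ge 0$ $$\tilde{\mathrm H}^q(\widetilde{\mathcal{SV}}/\langle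 M\rangle,\mathbb{C})\cong\tilde{\mathrm H}^q(\widetilde{\mathcal{SV}},\mathbb{C})\quad\text{as }\mathbb{C}[\partial]\text{-modules},\qquad \mathrm H^q(\widetilde{\mathcal{SV}}/\langle M\rangle,\mathbb{C})\cong\mathrm H^q(\widetilde{\mathcal{SV}},\mathbb{C})\quad\text{as complex vector spaces}.$$ -/

import Mathlib

open Polynomial

set_option linter.unusedSectionVars false

noncomputable section

/-! ### Lie conformal algebras -/

/-- A Lie conformal algebra over `ℂ`. The action of `∂` on the `ℂ[∂]`-module `A` is that of
`X : ℂ[X]`. An element `∑ λⁿ cₙ` of `ℂ[λ] ⊗ A` is stored as its finitely supported coefficient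
family `c : ℕ →₀ A`. Identities in `ℂ[λ] ⊗ A` and `ℂ[λ, μ] ⊗ A` are imposed for all complex values
of `λ` and `μ`, which is the same thing since `ℂ` is infinite. -/
class LieConformalAlgebra (A : Type*) [AddCommGroup A] [Module ℂ A] [Module ℂ[X] A]
    [IsScalarTower ℂ ℂ[X] A] where
  /-- the `λ`-bracket `a ⊗ b ↦ [a_λ b]` -/
  bracket : A →ₗ[ℂ] A →ₗ[ℂ] (ℕ →₀ A)
  /-- `[∂a_λ b] = -λ [a_λ b]` -/
  sesq_left : ∀ (l : ℂ) (a b : A),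
    ((bracket ((X : ℂ[X]) • a) b).sum fun n c => l ^ n • c)
      = -(l • (bracket a b).sum fun n c => l ^ n • c)
  /-- `[a_λ ∂b] = (∂ + λ) [a_λ b]` -/
  sesq_right : ∀ (l : ℂ) (a b : A),
    ((bracket a ((X : ℂ[X]) • b)).sum fun n c => l ^ n • c)
      = (X + C l : ℂ[X]) • (bracket a b).sum fun n c => l ^ n • c
  /-- `[a_λ b] = -[b_{-λ-∂} a]` -/
  skew : ∀ (l : ℂ) (a b : A),
    ((bracket a b).sum fun n c => l ^ n • c)
      = -(bracket b a).sum fun n c => ((-C l - X) ^ n : ℂ[X]) • c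
  /-- `[a_λ [b_μ c]] = [[a_λ b]_{λ+μ} c] + [b_μ [a_λ c]]` -/
  jacobi : ∀ (l m : ℂ) (a b c : A),
    ((bracket a ((bracket b c).sum fun n e => m ^ n • e)).sum fun n e => l ^ n • e)
      = ((bracket ((bracket a b).sum fun n e => l ^ n • e) c).sum fun n e => (l + m) ^ n • e)
        + (bracket b ((bracket a c).sum fun n e => l ^ n • e)).sum fun n e => m ^ n • e

namespace LieConformalAlgebra

section Quotient

variable {A : Type*} [AddCommGroup A] [Module ℂ A] [Module ℂ[X] A] [IsScalarTower ℂ ℂ[X] A]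
  [LieConformalAlgebra A]

/-- A (two-sided) ideal: a `ℂ[∂]`-submodule `I` with `[a_λ b], [b_λ a] ∈ I[λ]` for `a ∈ A`,
`b ∈ I`. -/
structure IsIdeal (I : Submodule ℂ[X] A) : Prop where
  right_mem : ∀ (a : A), ∀ b ∈ I, ∀ n : ℕ, bracket a b n ∈ I
  left_mem : ∀ (a : A), ∀ b ∈ I, ∀ n : ℕ, bracket b a n ∈ I

/-- The projection `A → A/I`, as a `ℂ`-linear map. -/
def proj (I : Submodule ℂ[X] A) : A →ₗ[ℂ] A ⧸ I := I.mkQ.restrictScalars ℂ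

/-- A `ℂ`-linear map that vanishes on `I` descends to `A/I`. -/
def descend {B : Type*} [AddCommMonoid B] [Module ℂ B] (I : Submodule ℂ[X] A) (f : A →ₗ[ℂ] B)
    (hf : ∀ b ∈ I, f b = 0) : (A ⧸ I) →ₗ[ℂ] B where
  toFun := Quotient.lift f (by
    intro a b hab
    have h : a - b ∈ I := (Submodule.quotientRel_def I).1 hab
    rw [← sub_add_cancel a b, map_add, hf _ h, zero_add])
  map_add' := by
    rintro ⟨a⟩ ⟨b⟩
    exact map_add f a b
  map_smul' := by
    rintro r ⟨a⟩
    exact map_smul f r a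

theorem descend_proj {B : Type*} [AddCommMonoid B] [Module ℂ B] (I : Submodule ℂ[X] A)
    (f : A →ₗ[ℂ] B) (hf : ∀ b ∈ I, f b = 0) (a : A) : descend I f hf (proj I a) = f a :=
  rfl

theorem proj_surjective (I : Submodule ℂ[X] A) : Function.Surjective (proj I) :=
  Submodule.Quotient.mk_surjective I

/-- The map `a ↦ ([a_λ ·] mod I)` as a map into `ℂ`-linear maps on `A/I`. -/
def halfBracket (I : Submodule ℂ[X] A) (hI : IsIdeal I) : A →ₗ[ℂ] (A ⧸ I) →ₗ[ℂ] (ℕ →₀ A ⧸ I) where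
  toFun a := descend I ((Finsupp.mapRange.linearMap (proj I)).comp (bracket a)) (by
    intro b hb
    ext n
    simpa [proj] using hI.right_mem a b hb n)
  map_add' a a' := by
    refine LinearMap.ext fun y => ?_
    obtain ⟨b, rfl⟩ := proj_surjective I y
    simp only [LinearMap.add_apply, descend_proj, LinearMap.comp_apply, map_add]
  map_smul' r a := by
    refine LinearMap.ext fun y => ?_
    obtain ⟨b, rfl⟩ := proj_surjective I y
    simp only [LinearMap.smul_apply, descend_proj, LinearMap.comp_apply, map_smul,
      RingHom.id_apply]

theorem halfBracket_proj (I : Submodule ℂ[X] A) (hI : IsIdeal I) (a b : A) :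
    halfBracket I hI a (proj I b) = Finsupp.mapRange.linearMap (proj I) (bracket a b) :=
  rfl

theorem halfBracket_eq_zero (I : Submodule ℂ[X] A) (hI : IsIdeal I) (a : A) (ha : a ∈ I) :
    halfBracket I hI a = 0 := by
  refine LinearMap.ext fun y => ?_
  obtain ⟨b, rfl⟩ := proj_surjective I y
  rw [halfBracket_proj]
  ext n
  simpa [proj] using hI.left_mem b a ha n

/-- The `λ`-bracket on `A/I` induced by that of `A`. -/
def quotientBracket (I : Submodule ℂ[X] A) (hI : IsIdeal I) :
    (A ⧸ I) →ₗ[ℂ] (A ⧸ I) →ₗ[ℂ] (ℕ →₀ A ⧸ I) :=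
  descend I (halfBracket I hI) (halfBracket_eq_zero I hI)

theorem quotientBracket_proj (I : Submodule ℂ[X] A) (hI : IsIdeal I) (a b : A) :
    quotientBracket I hI (proj I a) (proj I b)
      = Finsupp.mapRange.linearMap (proj I) (bracket a b) := by
  rw [quotientBracket, descend_proj, halfBracket_proj]

theorem sum_mapRange_proj (I : Submodule ℂ[X] A) (f : ℕ →₀ A) (p : ℕ → ℂ[X]) :
    ((Finsupp.mapRange.linearMap (proj I) f).sum fun n c => p n • c)
      = proj I (f.sum fun n c => p n • c) := by
  rw [Finsupp.mapRange.linearMap_apply, Finsupp.sum_mapRange_index (by simp), Finsupp.sum,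
    Finsupp.sum, map_sum]
  rfl

theorem sum_mapRange_proj' (I : Submodule ℂ[X] A) (f : ℕ →₀ A) (p : ℕ → ℂ) :
    ((Finsupp.mapRange.linearMap (proj I) f).sum fun n c => p n • c)
      = proj I (f.sum fun n c => p n • c) := by
  rw [Finsupp.mapRange.linearMap_apply, Finsupp.sum_mapRange_index (by simp), Finsupp.sum,
    Finsupp.sum, map_sum]
  simp

/-- The quotient Lie conformal algebra `A/I`. -/
@[reducible] def quotient (I : Submodule ℂ[X] A) (hI : IsIdeal I) :
    LieConformalAlgebra (A ⧸ I) where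
  bracket := quotientBracket I hI
  sesq_left l x y := by
    obtain ⟨a, rfl⟩ : ∃ a, proj I a = x := Submodule.Quotient.mk_surjective _ x
    obtain ⟨b, rfl⟩ : ∃ b, proj I b = y := Submodule.Quotient.mk_surjective _ y
    have h : (X : ℂ[X]) • proj I a = proj I ((X : ℂ[X]) • a) := rfl
    simp only [h, quotientBracket_proj, sum_mapRange_proj', sesq_left, map_neg, map_smul]
  sesq_right l x y := by
    obtain ⟨a, rfl⟩ : ∃ a, proj I a = x := Submodule.Quotient.mk_surjective _ x
    obtain ⟨b, rfl⟩ : ∃ b, proj I b = y := Submodule.Quotient.mk_surjective _ y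
    have h : ∀ (p : ℂ[X]) (c : A), p • proj I c = proj I (p • c) := fun _ _ => rfl
    simp only [h, quotientBracket_proj, sum_mapRange_proj', sesq_right]
  skew l x y := by
    obtain ⟨a, rfl⟩ : ∃ a, proj I a = x := Submodule.Quotient.mk_surjective _ x
    obtain ⟨b, rfl⟩ : ∃ b, proj I b = y := Submodule.Quotient.mk_surjective _ y
    rw [quotientBracket_proj, quotientBracket_proj, sum_mapRange_proj', sum_mapRange_proj,
      skew l a b, map_neg]
  jacobi l m x y z := by
    obtain ⟨a, rfl⟩ : ∃ a, proj I a = x := Submodule.Quotient.mk_surjective _ x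
    obtain ⟨b, rfl⟩ : ∃ b, proj I b = y := Submodule.Quotient.mk_surjective _ y
    obtain ⟨c, rfl⟩ : ∃ c, proj I c = z := Submodule.Quotient.mk_surjective _ z
    simp only [quotientBracket_proj, sum_mapRange_proj', ← map_add]
    rw [jacobi]

end Quotient

/-! ### Basic and reduced cohomology with coefficients in the trivial module `ℂ` -/

section Cohomology

variable (A : Type*) [AddCommGroup A] [Module ℂ A] [Module ℂ[X] A] [IsScalarTower ℂ ℂ[X] A]

/-- Arbitrary maps `(a₁, …, aₙ) ↦ γ_{λ₁,…,λₙ}(a₁, …, aₙ) ∈ ℂ[λ₁, …, λₙ]`; the variable `λᵢ` is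
`MvPolynomial.X i`. -/
abbrev PreCochain (n : ℕ) : Type _ := (Fin n → A) → MvPolynomial (Fin n) ℂ

/-- The space `C̃ⁿ(A, ℂ)` of `n`-cochains: the `ℂ`-multilinear, conformally antilinear maps that
are skew-symmetric under simultaneous permutations of the `aᵢ` and the `λᵢ`. -/
def cochains (n : ℕ) : Submodule ℂ (PreCochain A n) where
  carrier := {γ |
    (∃ g : MultilinearMap ℂ (fun _ : Fin n => A) (MvPolynomial (Fin n) ℂ), ⇑g = γ) ∧
    (∀ (a : Fin n → A) (i : Fin n),
      γ (Function.update a i ((X : ℂ[X]) • a i)) = -(MvPolynomial.X i * γ a)) ∧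
    (∀ (σ : Equiv.Perm (Fin n)) (a : Fin n → A),
      MvPolynomial.rename σ (γ (a ∘ σ)) = (Equiv.Perm.sign σ : ℤ) • γ a)}
  zero_mem' := ⟨⟨0, rfl⟩, by simp, by simp⟩
  add_mem' := by
    rintro _ _ ⟨⟨g, rfl⟩, h1, h2⟩ ⟨⟨g', rfl⟩, h1', h2'⟩
    refine ⟨⟨g + g', rfl⟩, fun a i => ?_, fun σ a => ?_⟩
    · simp only [Pi.add_apply, h1, h1']; ring
    · simp only [Pi.add_apply, map_add, h2, h2', smul_add]
  smul_mem' := by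
    rintro r _ ⟨⟨g, rfl⟩, h1, h2⟩
    refine ⟨⟨r • g, rfl⟩, fun a i => ?_, fun σ a => ?_⟩
    · simp only [Pi.smul_apply, h1, smul_neg, mul_smul_comm]
    · simp only [Pi.smul_apply, map_smul, h2, smul_comm r]

/-- The action of `∂` on cochains with coefficients in `ℂ`: multiplication by `λ₁ + ⋯ + λₙ`. -/
def del (n : ℕ) : PreCochain A n →ₗ[ℂ] PreCochain A n where
  toFun γ a := (∑ i, MvPolynomial.X i) * γ a
  map_add' γ γ' := by ext1 a; simp [mul_add]
  map_smul' r γ := by ext1 a; simp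

variable [LieConformalAlgebra A]

variable {A} in
/-- The term
`γ_{λᵢ+λⱼ, λ₁, …, λ̂ᵢ, …, λ̂ⱼ, …}([aᵢ_{λᵢ} aⱼ], a₁, …, âᵢ, …, âⱼ, …)`
of the differential, for `i < j`; `γ` is extended linearly over polynomials in the `λ`'s. -/
def differentialTerm {m : ℕ} (γ : PreCochain A (m + 1)) (a : Fin (m + 2) → A)
    (i : Fin (m + 1)) (j : Fin (m + 2)) : MvPolynomial (Fin (m + 2)) ℂ :=
  (bracket (a i.castSucc) (a j)).sum fun k c =>
    MvPolynomial.X i.castSucc ^ k *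
      MvPolynomial.aeval
        (Fin.cons (MvPolynomial.X i.castSucc + MvPolynomial.X j)
          (fun l => MvPolynomial.X (j.succAbove (i.succAbove l))) :
          Fin (m + 1) → MvPolynomial (Fin (m + 2)) ℂ)
        (γ (Fin.cons c fun l => a (j.succAbove (i.succAbove l))))

/-- The differential `dₙ` for the trivial module `ℂ`, the alternating sum of the above terms over
`i < j`. In degree `0` it vanishes, as the action of `A` on `ℂ` is zero. -/
def differential : (n : ℕ) → PreCochain A n →ₗ[ℂ] PreCochain A (n + 1)
  | 0 => 0
  | m + 1 =>
    { toFun := fun γ a => ∑ j : Fin (m + 2), ∑ i : Fin (m + 1),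
        if i.castSucc < j then (-1) ^ (i.val + j.val) * differentialTerm γ a i j else 0
      map_add' := fun γ γ' => by
        ext1 a
        simp only [Pi.add_apply, ← Finset.sum_add_distrib]
        refine Finset.sum_congr rfl fun j _ => Finset.sum_congr rfl fun i _ => ?_
        split_ifs
        · simp only [differentialTerm, Pi.add_apply, map_add, mul_add, Finsupp.sum_add]
        · simp
      map_smul' := fun r γ => by
        ext1 a
        simp only [Pi.smul_apply, Finset.smul_sum, RingHom.id_apply]
        refine Finset.sum_congr rfl fun j _ => Finset.sum_congr rfl fun i _ => ?_
        split_ifs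
        · simp only [differentialTerm, Pi.smul_apply, map_smul, mul_smul_comm, Finsupp.sum,
            ← Finset.smul_sum]
        · simp }

/-- The space of basic `q`-cocycles. -/
def basicCocycles (q : ℕ) : Submodule ℂ (PreCochain A q) :=
  cochains A q ⊓ LinearMap.ker (differential A q)

/-- The space `d C̃^{q-1}` of basic `q`-coboundaries. -/
def basicCoboundaries : (q : ℕ) → Submodule ℂ (PreCochain A q)
  | 0 => ⊥
  | q + 1 => (cochains A q).map (differential A q)

/-- The basic cohomology `H̃^q(A, ℂ)`: cocycles modulo coboundaries. -/
abbrev BasicCohomology (q : ℕ) : Type _ :=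
  basicCocycles A q ⧸ (basicCoboundaries A q).submoduleOf (basicCocycles A q)

/-- Cochains representing cocycles of the reduced complex `C̃ / ∂C̃`: those `γ ∈ C̃^q` with
`dγ ∈ ∂C̃^{q+1}`. -/
def reducedCocycles (q : ℕ) : Submodule ℂ (PreCochain A q) :=
  cochains A q ⊓ ((cochains A (q + 1)).map (del A (q + 1))).comap (differential A q)

/-- Cochains representing coboundaries of the reduced complex: `dC̃^{q-1} + ∂C̃^q`. -/
def reducedCoboundaries (q : ℕ) : Submodule ℂ (PreCochain A q) :=
  basicCoboundaries A q ⊔ (cochains A q).map (del A q)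

/-- The reduced cohomology `H^q(A, ℂ)`, the cohomology of the quotient complex `C̃ / ∂C̃`. -/
abbrev ReducedCohomology (q : ℕ) : Type _ :=
  reducedCocycles A q ⧸ (reducedCoboundaries A q).submoduleOf (reducedCocycles A q)

theorem differential_del (n : ℕ) (γ : PreCochain A n) :
    differential A n (del A n γ) = del A (n + 1) (differential A n γ) := by
  cases n with
  | zero => simp [differential]
  | succ m =>
    ext1 a
    simp only [differential, del, LinearMap.coe_mk, AddHom.coe_mk]
    rw [Finset.mul_sum]
    refine Finset.sum_congr rfl fun j _ => ?_
    rw [Finset.mul_sum]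
    refine Finset.sum_congr rfl fun i _ => ?_
    split_ifs with hij
    · have hs : MvPolynomial.aeval
          (Fin.cons (MvPolynomial.X i.castSucc + MvPolynomial.X j)
            (fun l => MvPolynomial.X (j.succAbove (i.succAbove l))) :
            Fin (m + 1) → MvPolynomial (Fin (m + 2)) ℂ)
          (∑ l : Fin (m + 1), (MvPolynomial.X l : MvPolynomial (Fin (m + 1)) ℂ))
          = ∑ l : Fin (m + 2), MvPolynomial.X l := by
        rw [map_sum, Fin.sum_univ_succ, Fin.sum_univ_succAbove _ j, Fin.sum_univ_succAbove _ i,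
          Fin.succAbove_of_castSucc_lt _ _ hij]
        simp only [MvPolynomial.aeval_X, Fin.cons_zero, Fin.cons_succ]
        ring
      simp only [differentialTerm, map_mul, hs]
      rw [Finsupp.sum, Finsupp.sum, Finset.mul_sum, Finset.mul_sum, Finset.mul_sum]
      refine Finset.sum_congr rfl fun k _ => ?_
      ring
    · simp

theorem del_mem_cochains (n : ℕ) {γ : PreCochain A n} (h : γ ∈ cochains A n) :
    del A n γ ∈ cochains A n := by
  obtain ⟨⟨g, rfl⟩, h1, h2⟩ := h
  refine ⟨⟨(LinearMap.mulLeft ℂ (∑ i, MvPolynomial.X i)).compMultilinearMap g, rfl⟩,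
    fun a i => ?_, fun σ a => ?_⟩
  · simp only [del, LinearMap.coe_mk, AddHom.coe_mk, h1]; ring
  · simp only [del, LinearMap.coe_mk, AddHom.coe_mk, map_mul, h2, map_sum,
      MvPolynomial.rename_X, mul_smul_comm]
    rw [Equiv.sum_comp σ fun i => (MvPolynomial.X i : MvPolynomial (Fin n) ℂ)]

theorem del_mem_basicCocycles (q : ℕ) (γ : PreCochain A q) (h : γ ∈ basicCocycles A q) :
    del A q γ ∈ basicCocycles A q := by
  refine ⟨del_mem_cochains A q h.1, ?_⟩
  have h2 : differential A q γ = 0 := h.2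
  simp [LinearMap.mem_ker, differential_del, h2]

theorem del_mem_basicCoboundaries (q : ℕ) (γ : PreCochain A q)
    (h : γ ∈ basicCoboundaries A q) : del A q γ ∈ basicCoboundaries A q := by
  cases q with
  | zero =>
    have h0 : γ = 0 := h
    simp [h0]
  | succ m =>
    obtain ⟨φ, hφ, rfl⟩ := h
    exact ⟨del A m φ, del_mem_cochains A m hφ, differential_del A m φ⟩

/-- The action of `∂` on `H̃^q(A, ℂ)`, which makes it a `ℂ[∂]`-module. -/
def BasicCohomology.del (q : ℕ) : BasicCohomology A q →ₗ[ℂ] BasicCohomology A q :=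
  Submodule.mapQ _ _
    ((LieConformalAlgebra.del A q).restrict (del_mem_basicCocycles A q))
    (fun γ hγ => del_mem_basicCoboundaries A q γ.1 hγ)

end Cohomology

end LieConformalAlgebra

/-! ### The extended Schrödinger–Virasoro conformal algebra and its quotient by `⟨M⟩` -/

namespace ExtendedSV

open LieConformalAlgebra

/-- The free generators. -/
inductive Gen
  | L | N | Y | M
  deriving DecidableEq

instance : Fintype Gen := ⟨{.L, .N, .Y, .M}, by intro x; cases x <;> simp⟩

/-- The free `ℂ[∂]`-module with basis `L, N, Y, M`. -/
abbrev SV : Type := Gen → ℂ[X]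

/-- The coefficient in `ℂ[∂][λ]` of the generator `z` in `[x_λ y]`: the inner variable `C X` is
`∂`, the outer variable `X` is `λ`. -/
def structureConst : Gen → Gen → Gen → ℂ[X][X]
  | .L, .L, .L => C X + 2 * X
  | .L, .Y, .Y => C X + C (C (3 / 2)) * X
  | .Y, .L, .Y => C (C (1 / 2) * X) + C (C (3 / 2)) * X
  | .Y, .Y, .M => C X + 2 * X
  | .L, .M, .M => C X + X
  | .M, .L, .M => X
  | .L, .N, .N => C X + X
  | .N, .L, .N => X
  | .N, .Y, .Y => 1
  | .Y, .N, .Y => -1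
  | .N, .M, .M => 2
  | .M, .N, .M => -2
  | _, _, _ => 0

/-- The element `P z` of `ℂ[λ] ⊗ (ℂ[∂]L ⊕ ℂ[∂]N ⊕ ℂ[∂]Y ⊕ ℂ[∂]M)`, for `P ∈ ℂ[∂][λ]` and a
generator `z`. -/
def toCoeffs (z : Gen) : ℂ[X][X] →ₗ[ℂ] (ℕ →₀ SV) :=
  Polynomial.lsum fun n =>
    (Finsupp.lsingle n).comp (LinearMap.single ℂ (fun _ : Gen => ℂ[X]) z)

/-- The `λ`-bracket, `[p(∂)x_λ q(∂)y] = p(-λ) q(∂+λ) [x_λ y]` for generators `x`, `y`. -/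
def svBracket : SV →ₗ[ℂ] SV →ₗ[ℂ] (ℕ →₀ SV) :=
  LinearMap.mk₂ ℂ
    (fun p q => ∑ x, ∑ y, ∑ z, toCoeffs z
      (aeval (-X : ℂ[X][X]) (p x) * aeval (C X + X : ℂ[X][X]) (q y) * structureConst x y z))
    (by intro p p' q; simp [add_mul, Finset.sum_add_distrib])
    (by intro r p q; simp [Finset.smul_sum])
    (by intro p q q'; simp [mul_add, add_mul, Finset.sum_add_distrib])
    (by intro r p q; simp [Finset.smul_sum])

/-- The map `∑ λⁿ cₙ ↦ ∑ rⁿ cₙ`, for `r ∈ ℂ[∂]`. -/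
def evalCoeffs (r : ℂ[X]) : (ℕ →₀ SV) →ₗ[ℂ] SV :=
  Finsupp.lsum ℂ fun n => ((LinearMap.lsmul ℂ[X] SV (r ^ n)).restrictScalars ℂ : SV →ₗ[ℂ] SV)

theorem evalCoeffs_apply (r : ℂ[X]) (f : ℕ →₀ SV) :
    evalCoeffs r f = f.sum fun n c => r ^ n • c := rfl

theorem evalCoeffs_toCoeffs (z : Gen) (P : ℂ[X][X]) (r : ℂ[X]) :
    evalCoeffs r (toCoeffs z P) = Pi.single z (P.eval r) := by
  induction P using Polynomial.induction_on' with
  | add p q hp hq => rw [map_add, map_add, hp, hq, eval_add, Pi.single_add]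
  | monomial n a =>
    simp only [toCoeffs, Polynomial.lsum_apply]
    rw [Polynomial.sum_monomial_index _ _ (by simp)]
    simp [evalCoeffs, ← Pi.single_smul, mul_comm]

theorem eval_aeval (f : ℂ[X]) (s : ℂ[X][X]) (r : ℂ[X]) :
    (aeval s f).eval r = f.comp (s.eval r) := by
  rw [← Polynomial.coe_evalRingHom, Polynomial.aeval_def, Polynomial.hom_eval₂, Polynomial.comp]
  congr 1
  ext x
  simp [Polynomial.algebraMap_apply]

theorem sum_svBracket (p q : SV) (r : ℂ[X]) (z : Gen) :
    ((svBracket p q).sum fun n c => r ^ n • c) z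
      = ∑ x, ∑ y, (p x).comp (-r) * (q y).comp (X + r) * (structureConst x y z).eval r := by
  rw [← evalCoeffs_apply]
  simp only [svBracket, LinearMap.mk₂_apply, map_sum, evalCoeffs_toCoeffs, Finset.sum_apply,
    Finset.sum_pi_single, Finset.mem_univ, if_true, eval_mul, eval_aeval]
  simp

theorem sum_svBracket' (p q : SV) (l : ℂ) (z : Gen) :
    ((svBracket p q).sum fun n c => l ^ n • c) z
      = ∑ x, ∑ y, (p x).comp (-C l) * (q y).comp (X + C l)
          * (structureConst x y z).eval (C l) := by
  rw [← sum_svBracket]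
  refine congrFun (?_ : Finsupp.sum _ _ = Finsupp.sum _ _) z
  refine Finset.sum_congr rfl fun n _ => ?_
  ext1 w
  change l ^ n • svBracket p q n w = C l ^ n * svBracket p q n w
  rw [← C_pow, smul_eq_C_mul]

theorem sum_rotate {B : Type*} [AddCommMonoid B] (F : Gen → Gen → Gen → B) :
    ∑ w, ∑ v, ∑ x, F w v x = ∑ x, ∑ w, ∑ v, F w v x :=
  (Finset.sum_congr rfl fun _ _ => Finset.sum_comm).trans Finset.sum_comm

theorem rearrange_right (P Q R : Gen → ℂ[X]) (S T : Gen → Gen → Gen → ℂ[X]) (z : Gen) :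
    ∑ x, ∑ w, (P x * ∑ y, ∑ v, Q y * R v * S y v w) * T x w z
      = ∑ x, ∑ y, ∑ v, P x * Q y * R v * ∑ w, S y v w * T x w z := by
  refine Finset.sum_congr rfl fun x _ => ?_
  simp only [Finset.mul_sum, Finset.sum_mul]
  rw [Finset.sum_comm]
  refine Finset.sum_congr rfl fun y _ => ?_
  rw [Finset.sum_comm]
  refine Finset.sum_congr rfl fun v _ => Finset.sum_congr rfl fun w _ => ?_
  ring

theorem rearrange_left (P Q R : Gen → ℂ[X]) (S T : Gen → Gen → Gen → ℂ[X]) (z : Gen) :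
    ∑ w, ∑ v, (∑ x, ∑ y, P x * Q y * S x y w) * R v * T w v z
      = ∑ x, ∑ y, ∑ v, P x * Q y * R v * ∑ w, S x y w * T w v z := by
  simp only [Finset.mul_sum, Finset.sum_mul]
  rw [sum_rotate]
  refine Finset.sum_congr rfl fun x _ => ?_
  rw [sum_rotate]
  refine Finset.sum_congr rfl fun y _ => ?_
  rw [Finset.sum_comm]
  refine Finset.sum_congr rfl fun v _ => Finset.sum_congr rfl fun w _ => ?_
  ring

theorem sum_gen {B : Type*} [AddCommMonoid B] (f : Gen → B) :
    ∑ x, f x = f .L + (f .N + (f .Y + f .M)) := by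
  change ∑ x ∈ ({.L, .N, .Y, .M} : Finset Gen), f x = _
  rw [Finset.sum_insert (by simp), Finset.sum_insert (by simp), Finset.sum_insert (by simp),
    Finset.sum_singleton]

theorem C_half : (C (1 / 2 : ℂ) : ℂ[X]) * 2 = 1 := by
  rw [show (2 : ℂ[X]) = C 2 from rfl, ← C_mul]; norm_num

theorem C_three_half : (C (3 / 2 : ℂ) : ℂ[X]) = 3 * C (1 / 2) := by
  rw [show (3 : ℂ[X]) = C 3 from rfl, ← C_mul]; norm_num

theorem structureConst_skew (x y z : Gen) (l : ℂ) :
    (structureConst x y z).eval (C l) = -(structureConst y x z).eval (-C l - X) := by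
  have h := C_half
  cases x <;> cases y <;> cases z <;> simp only [structureConst, C_three_half, eval_add, eval_mul,
    eval_C, eval_X, eval_ofNat, eval_one, eval_neg, eval_zero, neg_zero] <;> grind

theorem structureConst_jacobi (x y v z : Gen) (l m : ℂ) :
    ∑ w, ((structureConst y v w).eval (C m)).comp (X + C l) * (structureConst x w z).eval (C l)
      = ∑ w, ((structureConst x y w).eval (C l)).comp (-C (l + m))
            * (structureConst w v z).eval (C (l + m))
        + ∑ w, ((structureConst x v w).eval (C l)).comp (X + C m)
            * (structureConst y w z).eval (C m) := by
  have h := C_half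
  simp only [sum_gen]
  cases x <;> cases y <;> cases v <;> cases z <;> simp only [structureConst, C_three_half,
    eval_add, eval_mul, eval_C, eval_X, eval_ofNat, eval_one, eval_neg, eval_zero,
    add_comp, mul_comp, C_comp, X_comp, ofNat_comp, one_comp, neg_comp, zero_comp, C_add,
    zero_mul, mul_zero, add_zero, zero_add] <;> grind

instance instLieConformalAlgebra : LieConformalAlgebra SV where
  bracket := svBracket
  sesq_left l p q := by
    ext1 z
    simp only [sum_svBracket', Pi.neg_apply, Pi.smul_apply, smul_eq_mul, mul_comp, X_comp,
      Finset.smul_sum, ← Finset.sum_neg_distrib, smul_eq_C_mul]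
    refine Finset.sum_congr rfl fun x _ => Finset.sum_congr rfl fun y _ => ?_
    ring
  sesq_right l p q := by
    ext1 z
    simp only [sum_svBracket', Pi.smul_apply, smul_eq_mul, mul_comp, X_comp, Finset.mul_sum]
    refine Finset.sum_congr rfl fun x _ => Finset.sum_congr rfl fun y _ => ?_
    ring
  skew l p q := by
    ext1 z
    simp only [sum_svBracket', sum_svBracket, Pi.neg_apply, ← Finset.sum_neg_distrib]
    rw [Finset.sum_comm]
    refine Finset.sum_congr rfl fun x _ => Finset.sum_congr rfl fun y _ => ?_
    rw [structureConst_skew, show (X + (-C l - X) : ℂ[X]) = -C l by ring,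
      show (-(-C l - X) : ℂ[X]) = X + C l by ring]
    ring
  jacobi l m p q r := by
    ext1 z
    have h1 : (X + C m : ℂ[X]).comp (X + C l) = X + C (l + m) := by
      simp only [add_comp, X_comp, C_comp, C_add]; ring
    have h2 : (X + C l : ℂ[X]).comp (X + C m) = X + C (l + m) := by
      simp only [add_comp, X_comp, C_comp, C_add]; ring
    have h3 : (X + C l : ℂ[X]).comp (-C (l + m)) = -C m := by
      simp only [add_comp, X_comp, C_comp, C_add]; ring
    have h4 : ∀ (c : ℂ) (f : ℂ[X]), (-C c : ℂ[X]).comp f = -C c := by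
      intro c f; simp only [neg_comp, C_comp]
    rw [Pi.add_apply]
    simp only [sum_svBracket', sum_comp, mul_comp, comp_assoc, h1, h2, h3, h4]
    rw [rearrange_right (fun x => (p x).comp (-C l)) (fun y => (q y).comp (-C m))
        (fun v => (r v).comp (X + C (l + m)))
        (fun y v w => ((structureConst y v w).eval (C m)).comp (X + C l))
        (fun x w z => (structureConst x w z).eval (C l)),
      rearrange_right (fun y => (q y).comp (-C m)) (fun x => (p x).comp (-C l))
        (fun v => (r v).comp (X + C (l + m)))
        (fun x v w => ((structureConst x v w).eval (C l)).comp (X + C m))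
        (fun y w z => (structureConst y w z).eval (C m)),
      rearrange_left (fun x => (p x).comp (-C l)) (fun y => (q y).comp (-C m))
        (fun v => (r v).comp (X + C (l + m)))
        (fun x y w => ((structureConst x y w).eval (C l)).comp (-C (l + m)))
        (fun w v z => (structureConst w v z).eval (C (l + m))),
      Finset.sum_comm (f := fun y x => ∑ v, (q y).comp (-C m) * (p x).comp (-C l) * _ * _)]
    simp only [← Finset.sum_add_distrib]
    refine Finset.sum_congr rfl fun x _ => Finset.sum_congr rfl fun y _ =>
      Finset.sum_congr rfl fun v _ => ?_
    rw [structureConst_jacobi]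
    ring

/-- The `ℂ[∂]`-submodule `⟨M⟩ = ℂ[∂]M`. -/
def spanM : Submodule ℂ[X] SV := Submodule.span ℂ[X] {Pi.single Gen.M 1}

theorem mem_spanM {p : SV} : p ∈ spanM ↔ p .L = 0 ∧ p .N = 0 ∧ p .Y = 0 := by
  rw [spanM, Submodule.mem_span_singleton]
  constructor
  · rintro ⟨r, rfl⟩
    simp
  · rintro ⟨h1, h2, h3⟩
    refine ⟨p .M, ?_⟩
    ext1 x
    cases x <;> simp [h1, h2, h3]

theorem toCoeffs_apply (z w : Gen) (P : ℂ[X][X]) (n : ℕ) :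
    toCoeffs z P n w = if w = z then P.coeff n else 0 := by
  induction P using Polynomial.induction_on' with
  | add p q hp hq =>
    rw [map_add, Finsupp.add_apply, Pi.add_apply, hp, hq, coeff_add]
    split_ifs <;> simp
  | monomial k a =>
    simp only [toCoeffs, Polynomial.lsum_apply]
    rw [Polynomial.sum_monomial_index _ _ (by simp)]
    simp only [LinearMap.comp_apply, Finsupp.lsingle_apply, LinearMap.single_apply,
      Finsupp.single_apply, coeff_monomial]
    by_cases hk : k = n <;> by_cases hw : w = z
    · subst hw; simp [hk]
    · simp [hk, hw]
    · simp [hk]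
    · simp [hk]

theorem svBracket_apply (p q : SV) (n : ℕ) (z : Gen) :
    svBracket p q n z = ∑ x, ∑ y, (aeval (-X : ℂ[X][X]) (p x) * aeval (C X + X : ℂ[X][X]) (q y)
      * structureConst x y z).coeff n := by
  simp only [svBracket, LinearMap.mk₂_apply, Finsupp.finsetSum_apply, Finset.sum_apply,
    toCoeffs_apply, Finset.sum_ite_eq, Finset.mem_univ, if_true]

theorem isIdeal_spanM : IsIdeal spanM where
  right_mem p q hq n := by
    obtain ⟨h1, h2, h3⟩ := mem_spanM.1 hq
    refine mem_spanM.2 ⟨?_, ?_, ?_⟩ <;>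
    · change svBracket p q n _ = 0
      simp [svBracket_apply, sum_gen, h1, h2, h3, structureConst]
  left_mem p q hq n := by
    obtain ⟨h1, h2, h3⟩ := mem_spanM.1 hq
    refine mem_spanM.2 ⟨?_, ?_, ?_⟩ <;>
    · change svBracket q p n _ = 0
      simp [svBracket_apply, sum_gen, h1, h2, h3, structureConst]

/-- The quotient of the extended Schrödinger–Virasoro conformal algebra by `⟨M⟩`. -/
abbrev SVModM : Type := SV ⧸ spanM

instance instLieConformalAlgebraModM : LieConformalAlgebra SVModM :=
  LieConformalAlgebra.quotient spanM isIdeal_spanM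

end ExtendedSV

end

-- The zero mode of `N` acts diagonally on the generators `L, N, Y, M`, with eigenvalues (weights)
-- `0, 0, 1, 2`, and the λ-bracket adds weights. Hence for every complex `t`, including `t = 0`,
-- multiplication by `t ^ w` in weight `w` is an endomorphism `τ t`. The endomorphism `τ 0` retracts
-- the algebra onto its weight-zero part, spanned by `L` and `N`. It kills `M`, so it factors
-- through the quotient by `⟨M⟩`, and the quotient carries the same kind of retraction.
--
-- Contracting a cochain with `N` at `λ = 0` gives Cartan's formula `ι d + d ι = -θ`
-- (`contract_differential`), where `θ`, the Lie derivative, multiplies the part of total weight `W`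
-- by `W`. Everything of nonzero weight is therefore contractible. Dividing by `W` needs no
-- decomposition of cochains: the pullback along `τ k` multiplies weight `W` by `k ^ W`, total
-- weights in degree `n` are at most `2 * n`, and by Vandermonde some linear combination of these
-- pullbacks multiplies by `1 / W` for each such `W ≠ 0`. Composed with `θ` it is the identity minus
-- the pullback along `τ 0` (`lieDerivative_combination`), so that pullback is homotopic to the
-- identity in positive degrees (`IsWeightElement.exists_homotopy`). In degree zero it is the
-- identity.
--
-- The homotopy commutes with `∂`, so it also serves the reduced complex. Applied to the algebra and
-- to its quotient, it shows that the pullbacks along `projM` and `liftModM`, whose composites are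
-- the pullbacks along the two versions of `τ 0`, are inverse to each other in both cohomologies.

noncomputable section

namespace LieConformalAlgebra

-- Functoriality of cochains and of both cohomologies

section Pullback

variable {A B : Type*} [AddCommGroup A] [Module ℂ A] [Module ℂ[X] A] [IsScalarTower ℂ ℂ[X] A]
  [AddCommGroup B] [Module ℂ B] [Module ℂ[X] B] [IsScalarTower ℂ ℂ[X] B]

/-- The pullback of maps `Bⁿ → ℂ[λ₁, …, λₙ]` along `f : A → B`. -/
def pullback (f : A →ₗ[ℂ[X]] B) (n : ℕ) : PreCochain B n →ₗ[ℂ] PreCochain A n where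
  toFun γ a := γ fun i => f (a i)
  map_add' _ _ := rfl
  map_smul' _ _ := rfl

theorem pullback_apply (f : A →ₗ[ℂ[X]] B) (n : ℕ) (γ : PreCochain B n) (a : Fin n → A) :
    pullback f n γ a = γ fun i => f (a i) :=
  rfl

theorem pullback_mem_cochains (f : A →ₗ[ℂ[X]] B) {n : ℕ} {γ : PreCochain B n}
    (h : γ ∈ cochains B n) : pullback f n γ ∈ cochains A n := by
  obtain ⟨⟨g, rfl⟩, h1, h2⟩ := h
  refine ⟨⟨g.compLinearMap fun _ => f.restrictScalars ℂ, rfl⟩, fun a i => ?_, fun σ a => ?_⟩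
  · rw [pullback_apply, pullback_apply, ← h1]
    congr 1
    ext1 l
    by_cases hl : l = i
    · subst hl; simp
    · simp [hl]
  · exact h2 σ fun i => f (a i)

theorem pullback_del (f : A →ₗ[ℂ[X]] B) (n : ℕ) (γ : PreCochain B n) :
    pullback f n (del B n γ) = del A n (pullback f n γ) :=
  rfl

theorem cochain_cons_zero {n : ℕ} {γ : PreCochain A (n + 1)} (h : γ ∈ cochains A (n + 1))
    (a : Fin n → A) : γ (Fin.cons 0 a) = 0 := by
  obtain ⟨⟨g, rfl⟩, -, -⟩ := h
  exact g.map_coord_zero 0 (Fin.cons_zero _ _)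

variable [LieConformalAlgebra A] [LieConformalAlgebra B]

/-- Homomorphisms of Lie conformal algebras. -/
def IsHom (f : A →ₗ[ℂ[X]] B) : Prop :=
  ∀ a b : A, bracket (f a) (f b) = Finsupp.mapRange f (map_zero f) (bracket a b)

/-- The map `f` may kill coefficients of the bracket and so shrink its support; the lost terms
contribute nothing because a cochain vanishes when an argument is zero. -/
theorem differentialTerm_pullback {f : A →ₗ[ℂ[X]] B} (hf : IsHom f) {m : ℕ}
    {γ : PreCochain B (m + 1)} (hγ : γ ∈ cochains B (m + 1)) (a : Fin (m + 2) → A)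
    (i : Fin (m + 1)) (j : Fin (m + 2)) :
    differentialTerm (pullback f _ γ) a i j = differentialTerm γ (fun l => f (a l)) i j := by
  rw [differentialTerm, differentialTerm, hf, Finsupp.sum_mapRange_index]
  · refine Finsupp.sum_congr fun k _ => ?_
    rw [pullback_apply]
    congr 3
    ext1 l
    cases l using Fin.cases <;> rfl
  · intro k
    rw [cochain_cons_zero hγ, map_zero, mul_zero]

theorem differential_pullback {f : A →ₗ[ℂ[X]] B} (hf : IsHom f) {n : ℕ}
    {γ : PreCochain B n} (hγ : γ ∈ cochains B n) :
    differential A n (pullback f n γ) = pullback f (n + 1) (differential B n γ) := by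
  cases n with
  | zero => rfl
  | succ m =>
    ext1 a
    simp only [differential, LinearMap.coe_mk, AddHom.coe_mk, pullback_apply,
      differentialTerm_pullback hf hγ]

theorem pullback_mem_basicCocycles {f : A →ₗ[ℂ[X]] B} (hf : IsHom f) {q : ℕ}
    {γ : PreCochain B q} (hγ : γ ∈ basicCocycles B q) : pullback f q γ ∈ basicCocycles A q := by
  refine ⟨pullback_mem_cochains f hγ.1, ?_⟩
  rw [SetLike.mem_coe, LinearMap.mem_ker, differential_pullback hf hγ.1, LinearMap.mem_ker.1 hγ.2, map_zero]

theorem pullback_mem_basicCoboundaries {f : A →ₗ[ℂ[X]] B} (hf : IsHom f) {q : ℕ}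
    {γ : PreCochain B q} (hγ : γ ∈ basicCoboundaries B q) :
    pullback f q γ ∈ basicCoboundaries A q := by
  cases q with
  | zero =>
    have h0 : γ = 0 := hγ
    rw [h0, map_zero]
    exact zero_mem _
  | succ m =>
    obtain ⟨φ, hφ, rfl⟩ := hγ
    exact ⟨pullback f m φ, pullback_mem_cochains f hφ, differential_pullback hf hφ⟩

theorem pullback_mem_map_del (f : A →ₗ[ℂ[X]] B) {q : ℕ} {γ : PreCochain B q}
    (hγ : γ ∈ (cochains B q).map (del B q)) : pullback f q γ ∈ (cochains A q).map (del A q) := by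
  obtain ⟨φ, hφ, rfl⟩ := hγ
  exact ⟨pullback f q φ, pullback_mem_cochains f hφ, rfl⟩

theorem pullback_mem_reducedCocycles {f : A →ₗ[ℂ[X]] B} (hf : IsHom f) {q : ℕ}
    {γ : PreCochain B q} (hγ : γ ∈ reducedCocycles B q) :
    pullback f q γ ∈ reducedCocycles A q := by
  refine ⟨pullback_mem_cochains f hγ.1, ?_⟩
  rw [SetLike.mem_coe, Submodule.mem_comap, differential_pullback hf hγ.1]
  exact pullback_mem_map_del f hγ.2

theorem pullback_mem_reducedCoboundaries {f : A →ₗ[ℂ[X]] B} (hf : IsHom f) {q : ℕ}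
    {γ : PreCochain B q} (hγ : γ ∈ reducedCoboundaries B q) :
    pullback f q γ ∈ reducedCoboundaries A q := by
  obtain ⟨φ, hφ, ψ, hψ, rfl⟩ := Submodule.mem_sup.1 hγ
  rw [map_add]
  exact Submodule.add_mem_sup (pullback_mem_basicCoboundaries hf hφ) (pullback_mem_map_del f hψ)

end Pullback

-- Isomorphisms of subquotients

section Equivalence

/-- Linear maps `u : P → Q` and `v : Q → P` that preserve the submodules `P₁ ≤ P`, … and are
mutually inverse modulo `P₂` and `Q₂` induce an isomorphism of subquotients. -/
theorem exists_subquotientEquiv {P Q : Type*} [AddCommGroup P] [Module ℂ P] [AddCommGroup Q]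
    [Module ℂ Q] {P₁ P₂ : Submodule ℂ P} {Q₁ Q₂ : Submodule ℂ Q} (u : P →ₗ[ℂ] Q) (v : Q →ₗ[ℂ] P)
    (hu₁ : ∀ x ∈ P₁, u x ∈ Q₁) (hu₂ : ∀ x ∈ P₂, u x ∈ Q₂)
    (hv₁ : ∀ y ∈ Q₁, v y ∈ P₁) (hv₂ : ∀ y ∈ Q₂, v y ∈ P₂)
    (hvu : ∀ x ∈ P₁, x - v (u x) ∈ P₂) (huv : ∀ y ∈ Q₁, y - u (v y) ∈ Q₂) :
    ∃ e : (P₁ ⧸ P₂.submoduleOf P₁) ≃ₗ[ℂ] (Q₁ ⧸ Q₂.submoduleOf Q₁),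
      ∀ x : P₁, e (Submodule.Quotient.mk x) = Submodule.Quotient.mk ⟨u x, hu₁ x x.2⟩ := by
  refine ⟨LinearEquiv.ofLinearMap
    (Submodule.mapQ _ _ (u.restrict hu₁) fun x hx => hu₂ x.1 hx)
    (Submodule.mapQ _ _ (v.restrict hv₁) fun y hy => hv₂ y.1 hy) ?_ ?_, fun x => rfl⟩
  · refine Submodule.linearMap_qext _ (LinearMap.ext fun y => ?_)
    refine ((Submodule.Quotient.eq _).2 ?_).symm
    exact huv y.1 y.2
  · refine Submodule.linearMap_qext _ (LinearMap.ext fun x => ?_)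
    refine ((Submodule.Quotient.eq _).2 ?_).symm
    exact hvu x.1 x.2

end Equivalence

-- Contraction at `λ = 0` and Cartan's formula

section Cartan

variable {A : Type*} [AddCommGroup A] [Module ℂ A] [Module ℂ[X] A] [IsScalarTower ℂ ℂ[X] A]

/-- The contraction `(ι_x γ)_{λ₁,…,λₙ}(a₁, …, aₙ) = γ_{0,λ₁,…,λₙ}(x, a₁, …, aₙ)`. -/
def contract (x : A) (n : ℕ) : PreCochain A (n + 1) →ₗ[ℂ] PreCochain A n where
  toFun γ a := MvPolynomial.aeval
    (Fin.cons 0 MvPolynomial.X : Fin (n + 1) → MvPolynomial (Fin n) ℂ) (γ (Fin.cons x a))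
  map_add' γ γ' := by ext1 a; simp
  map_smul' r γ := by ext1 a; simp

theorem contract_apply (x : A) (n : ℕ) (γ : PreCochain A (n + 1)) (a : Fin n → A) :
    contract x n γ a = MvPolynomial.aeval
      (Fin.cons 0 MvPolynomial.X : Fin (n + 1) → MvPolynomial (Fin n) ℂ) (γ (Fin.cons x a)) :=
  rfl

theorem contract_mem_cochains (x : A) {n : ℕ} {γ : PreCochain A (n + 1)}
    (h : γ ∈ cochains A (n + 1)) : contract x n γ ∈ cochains A n := by
  obtain ⟨⟨g, rfl⟩, h1, h2⟩ := h
  refine ⟨⟨(MvPolynomial.aeval (Fin.cons 0 MvPolynomial.X :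
    Fin (n + 1) → MvPolynomial (Fin n) ℂ)).toLinearMap.compMultilinearMap (g.curryLeft x), rfl⟩,
    fun a i => ?_, fun σ a => ?_⟩
  · have h := h1 (Fin.cons x a) i.succ
    rw [Fin.cons_succ, ← Fin.cons_update] at h
    rw [contract_apply, h, map_neg, map_mul, MvPolynomial.aeval_X, Fin.cons_succ, contract_apply]
  -- This is `σ` extended by fixing the new first index, so it has the same sign.
  · have h := h2 (Equiv.Perm.decomposeFin.symm (0, σ)) (Fin.cons x a)
    have hc : (Fin.cons x a : Fin (n + 1) → A) ∘ Equiv.Perm.decomposeFin.symm (0, σ)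
        = Fin.cons x (a ∘ σ) := by
      ext1 l
      cases l using Fin.cases <;> simp
    rw [hc, Equiv.Perm.decomposeFin.symm_sign, if_pos rfl, one_mul] at h
    rw [contract_apply, contract_apply, ← map_zsmul, ← h, MvPolynomial.aeval_rename]
    change ((MvPolynomial.rename σ).comp (MvPolynomial.aeval _)) _ = _
    congr 1
    refine MvPolynomial.algHom_ext fun l => ?_
    cases l using Fin.cases <;> simp

/-- At `λ₀ = 0` the sum of all variables becomes the sum of the remaining ones. This lets the
contraction act on the reduced complex. -/
theorem contract_del (x : A) (n : ℕ) (γ : PreCochain A (n + 1)) :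
    contract x n (del A (n + 1) γ) = del A n (contract x n γ) := by
  ext1 a
  simp only [contract_apply, del, LinearMap.coe_mk, AddHom.coe_mk, map_mul, Fin.sum_univ_succ,
    map_add, map_sum, MvPolynomial.aeval_X, Fin.cons_zero, Fin.cons_succ, zero_add]

variable [LieConformalAlgebra A]

/-- The sum over `j` of `γ(a₁, …, [x_λ aⱼ]|_{λ=0}, …, aₙ)`. -/
def lieDerivative (x : A) (n : ℕ) (γ : PreCochain A n) : PreCochain A n :=
  fun a => ∑ j, γ (Function.update a j (bracket x (a j) 0))

/-- These are the terms that bracket `x` with an argument; they make up the Lie derivative. At `λ₀ =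
0` the variable `λ₀ + λⱼ` becomes `λⱼ`, and moving the bracket from the front back to slot `j` is a
cycle of sign `(-1) ^ j`. -/
theorem contract_differentialTerm_zero (x : A) {m : ℕ} {γ : PreCochain A (m + 1)}
    (h : γ ∈ cochains A (m + 1)) (a : Fin (m + 1) → A) (j : Fin (m + 1)) :
    MvPolynomial.aeval
        (Fin.cons 0 MvPolynomial.X : Fin (m + 2) → MvPolynomial (Fin (m + 1)) ℂ)
        (differentialTerm γ (Fin.cons x a) 0 j.succ)
      = (-1) ^ (j : ℕ) * γ (Function.update a j (bracket x (a j) 0)) := by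
  have hs := h.2.2 j.cycleRange.symm (Function.update a j (bracket x (a j) 0))
  have hc : Function.update a j (bracket x (a j) 0) ∘ j.cycleRange.symm
      = Fin.cons (bracket x (a j) 0) fun l => a (j.succAbove l) := by
    ext1 l
    cases l using Fin.cases <;> simp [Fin.succAbove_ne]
  rw [hc, Equiv.Perm.sign_symm, Fin.sign_cycleRange] at hs
  have hs' : (-1) ^ (j : ℕ) * γ (Function.update a j (bracket x (a j) 0))
      = MvPolynomial.rename j.cycleRange.symm
          (γ (Fin.cons (bracket x (a j) 0) fun l => a (j.succAbove l))) := by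
    rw [hs]
    simp [zsmul_eq_mul]
  rw [hs', differentialTerm, Finsupp.sum, map_sum]
  simp only [Fin.castSucc_zero, Fin.cons_zero, Fin.cons_succ, map_mul, map_pow,
    MvPolynomial.aeval_X]
  -- At `λ₀ = 0` only the constant coefficient of the bracket survives.
  rw [Finset.sum_eq_single 0]
  · rw [pow_zero, one_mul, ← AlgHom.comp_apply]
    have hv : (fun l : Fin m => (Fin.cons x a : Fin (m + 2) → A)
        (j.succ.succAbove ((0 : Fin (m + 1)).succAbove l))) = fun l => a (j.succAbove l) := by
      ext1 l
      simp
    rw [hv]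
    congr 1
    refine MvPolynomial.algHom_ext fun l => ?_
    cases l using Fin.cases <;> simp
  · intro k _ hk
    rw [zero_pow hk, zero_mul]
  · intro hk
    rw [Finsupp.notMem_support_iff.1 hk, cochain_cons_zero h, map_zero, map_zero, mul_zero]

/-- In the terms that do not bracket `x`, it sits just behind the bracket, while the contraction
wants it in front. One transposition gives the sign, so these terms cancel in Cartan's formula. -/
theorem contract_differentialTerm_succ (x : A) {m : ℕ} {γ : PreCochain A (m + 2)}
    (h : γ ∈ cochains A (m + 2)) (a : Fin (m + 2) → A) (i : Fin (m + 1)) (j : Fin (m + 2)) :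
    MvPolynomial.aeval
        (Fin.cons 0 MvPolynomial.X : Fin (m + 3) → MvPolynomial (Fin (m + 2)) ℂ)
        (differentialTerm γ (Fin.cons x a) i.succ j.succ)
      = -differentialTerm (contract x (m + 1) γ) a i j := by
  rw [differentialTerm, differentialTerm, Finsupp.sum, Finsupp.sum, map_sum,
    ← Finset.sum_neg_distrib]
  simp only [← Fin.succ_castSucc, Fin.cons_succ, map_mul, map_pow, MvPolynomial.aeval_X]
  refine Finset.sum_congr rfl fun k _ => ?_
  set c := bracket (a i.castSucc) (a j) k
  set v : Fin m → A := fun l => a (j.succAbove (i.succAbove l))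
  have hs := h.2.2 (Equiv.swap 0 1) (Fin.cons x (Fin.cons c v))
  have hc : (Fin.cons x (Fin.cons c v) : Fin (m + 2) → A) ∘ Equiv.swap 0 1
      = Fin.cons c (Fin.cons x v) := by
    ext1 l
    cases l using Fin.cases with
    | zero => simp
    | succ l =>
      cases l using Fin.cases with
      | zero => simp
      | succ l =>
        rw [Function.comp_apply, Equiv.swap_apply_of_ne_of_ne (Fin.succ_ne_zero _)
          (by simp [Fin.ext_iff])]
        simp
  rw [hc, Equiv.Perm.sign_swap (by simp)] at hs
  have hv : (fun l : Fin (m + 1) => (Fin.cons x a : Fin (m + 3) → A)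
      (j.succ.succAbove (i.succ.succAbove l))) = Fin.cons x v := by
    ext1 l
    cases l using Fin.cases <;> simp [v]
  have hs' : γ (Fin.cons x (Fin.cons c v))
      = -MvPolynomial.rename (Equiv.swap 0 1) (γ (Fin.cons c (Fin.cons x v))) := by
    rw [hs]; simp
  rw [hv, contract_apply, hs', map_neg, map_neg, mul_neg, neg_neg, MvPolynomial.aeval_rename,
    ← AlgHom.comp_apply, ← AlgHom.comp_apply]
  congr 2
  refine MvPolynomial.algHom_ext fun l => ?_
  cases l using Fin.cases with
  | zero => simp
  | succ l =>
    cases l using Fin.cases with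
    | zero => simp
    | succ l =>
      have hl : Equiv.swap (0 : Fin (m + 2)) 1 l.succ.succ = l.succ.succ :=
        Equiv.swap_apply_of_ne_of_ne (Fin.succ_ne_zero _) (by simp [Fin.ext_iff])
      simp [hl]

theorem contract_differential_apply (x : A) {m : ℕ} (γ : PreCochain A (m + 1))
    (a : Fin (m + 1) → A) :
    contract x (m + 1) (differential A (m + 1) γ) a
      = ∑ j : Fin (m + 1), ∑ i : Fin (m + 1), if i.castSucc < j.succ then
          (-1) ^ (i.val + (j.val + 1)) * MvPolynomial.aeval
            (Fin.cons 0 MvPolynomial.X : Fin (m + 2) → MvPolynomial (Fin (m + 1)) ℂ)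
            (differentialTerm γ (Fin.cons x a) i j.succ) else 0 := by
  rw [contract_apply]
  simp only [differential, LinearMap.coe_mk, AddHom.coe_mk]
  -- The summand with second index `0` is empty, since no first index is smaller.
  rw [Fin.sum_univ_succ]
  simp only [Fin.not_lt_zero, if_false, Finset.sum_const_zero, zero_add, map_sum, Fin.val_succ]
  refine Finset.sum_congr rfl fun j _ => Finset.sum_congr rfl fun i _ => ?_
  split_ifs
  · simp
  · simp

/-- Cartan's formula in degree one: the term `d ι` is absent because the differential vanishes in
degree zero. -/
theorem contract_differential_one (x : A) {γ : PreCochain A 1} (h : γ ∈ cochains A 1) :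
    contract x 1 (differential A 1 γ) = -lieDerivative x 1 γ := by
  ext1 a
  rw [contract_differential_apply, Pi.neg_apply, lieDerivative, Fin.sum_univ_one,
    Fin.sum_univ_one, Fin.sum_univ_one, if_pos (by simp), contract_differentialTerm_zero x h]
  simp

/-- Cartan's formula. -/
theorem contract_differential (x : A) {m : ℕ} {γ : PreCochain A (m + 2)}
    (h : γ ∈ cochains A (m + 2)) :
    contract x (m + 2) (differential A (m + 2) γ)
        + differential A (m + 1) (contract x (m + 1) γ)
      = -lieDerivative x (m + 2) γ := by
  ext1 a
  rw [Pi.add_apply, contract_differential_apply]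
  simp only [differential, LinearMap.coe_mk, AddHom.coe_mk]
  rw [← Finset.sum_add_distrib, Pi.neg_apply, lieDerivative, ← Finset.sum_neg_distrib]
  refine Finset.sum_congr rfl fun j _ => ?_
  -- The index `i = 0` yields the Lie derivative; all later ones cancel against the differential of
  -- the contraction.
  rw [Fin.sum_univ_succ, add_assoc, ← Finset.sum_add_distrib, Finset.sum_eq_zero, add_zero]
  -- The sign of the differential and that of the cycle combine to an exponent `2 * j + 1`.
  · rw [if_pos (by simp), contract_differentialTerm_zero x h, ← mul_assoc, ← pow_add,
      Odd.neg_one_pow ⟨j, by simp; ring⟩, neg_one_mul]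
  · intro i _
    simp only [← Fin.succ_castSucc, Fin.succ_lt_succ_iff]
    split_ifs
    · rw [contract_differentialTerm_succ x h, Fin.val_succ,
        show (i : ℕ) + 1 + (j + 1) = i + j + 2 by ring, pow_add]
      ring
    · rw [add_zero]

end Cartan

-- Weight gradings and the contracting homotopy

section Weights

variable {A : Type*} [AddCommGroup A] [Module ℂ A] [Module ℂ[X] A] [IsScalarTower ℂ ℂ[X] A]
  [LieConformalAlgebra A]

/-- An element `N` whose zero mode acts semisimply with eigenvalues among `0, 1, 2`, such that the
endomorphisms `τ t` acting by `tʷ` on the eigenspace for `w` are homomorphisms. -/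
structure IsWeightElement (N : A) (τ : ℂ → A →ₗ[ℂ[X]] A) : Prop where
  isHom : ∀ t, IsHom (τ t)
  exists_decomposition : ∀ a : A, ∃ f : Fin 3 → A, a = ∑ w, f w ∧
    ∀ w, bracket N (f w) 0 = ((w : ℕ) : ℂ) • f w ∧ ∀ t, τ t (f w) = t ^ (w : ℕ) • f w

/-- The Vandermonde matrix at the distinct nodes `0, …, n - 1` is invertible. The lemma supplies
combinations of the `τ k` that act by prescribed scalars on finitely many weights. -/
theorem exists_sum_mul_pow (n : ℕ) (b : ℕ → ℂ) :
    ∃ c : Fin n → ℂ, ∀ w < n, ∑ k : Fin n, c k * ((k : ℕ) : ℂ) ^ w = b w := by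
  set V : Matrix (Fin n) (Fin n) ℂ := Matrix.vandermonde fun k => ((k : ℕ) : ℂ)
  have hV : IsUnit V.det := (Matrix.det_vandermonde_ne_zero_iff.2 fun k l h =>
    Fin.ext (Nat.cast_injective h)).isUnit
  refine ⟨Matrix.vecMul (fun w : Fin n => b w) V⁻¹, fun w hw => ?_⟩
  have h : Matrix.vecMul (Matrix.vecMul (fun w : Fin n => b w) V⁻¹) V ⟨w, hw⟩ = b w := by
    rw [Matrix.vecMul_vecMul, Matrix.nonsing_inv_mul _ hV, Matrix.vecMul_one]
  exact h

variable {N : A} {τ : ℂ → A →ₗ[ℂ[X]] A}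

/-- Two multilinear maps that agree on families of weight vectors are equal. -/
theorem IsWeightElement.multilinear_ext (h : IsWeightElement N τ) {n : ℕ} {B : Type*}
    [AddCommGroup B] [Module ℂ B] {g g' : MultilinearMap ℂ (fun _ : Fin n => A) B}
    (hg : ∀ (v : Fin n → A) (w : Fin n → Fin 3),
      (∀ i, bracket N (v i) 0 = ((w i : ℕ) : ℂ) • v i) →
      (∀ i t, τ t (v i) = t ^ (w i : ℕ) • v i) → g v = g' v) : g = g' := by
  refine MultilinearMap.ext fun a => ?_
  choose f hf hf' using fun i => h.exists_decomposition (a i)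
  obtain rfl : a = fun i => ∑ w, f i w := funext hf
  rw [g.map_sum, g'.map_sum]
  exact Finset.sum_congr rfl fun r _ => hg _ r (fun i => (hf' i (r i)).1) fun i =>
    (hf' i (r i)).2

/-- A linear combination of the pullbacks along `τ 0, τ 1, …`. -/
def combination (τ : ℂ → A →ₗ[ℂ[X]] A) {K : ℕ} (c : Fin K → ℂ) (n : ℕ) :
    PreCochain A n →ₗ[ℂ] PreCochain A n :=
  ∑ k, c k • pullback (τ (k : ℕ)) n

theorem combination_apply {K : ℕ} (c : Fin K → ℂ) (n : ℕ) (γ : PreCochain A n) :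
    combination τ c n γ = ∑ k, c k • pullback (τ (k : ℕ)) n γ := by
  simp [combination]

theorem combination_mem_cochains {K : ℕ} (c : Fin K → ℂ) {n : ℕ} {γ : PreCochain A n}
    (hγ : γ ∈ cochains A n) : combination τ c n γ ∈ cochains A n := by
  rw [combination_apply]
  exact Submodule.sum_mem _ fun k _ => Submodule.smul_mem _ _ (pullback_mem_cochains _ hγ)

theorem differential_combination (h : IsWeightElement N τ) {K : ℕ} (c : Fin K → ℂ) {n : ℕ}
    {γ : PreCochain A n} (hγ : γ ∈ cochains A n) :
    differential A n (combination τ c n γ) = combination τ c (n + 1) (differential A n γ) := by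
  rw [combination_apply, combination_apply, map_sum]
  refine Finset.sum_congr rfl fun k _ => ?_
  rw [map_smul, differential_pullback (h.isHom _) hγ]

theorem combination_del {K : ℕ} (c : Fin K → ℂ) (n : ℕ) (γ : PreCochain A n) :
    combination τ c n (del A n γ) = del A n (combination τ c n γ) := by
  rw [combination_apply, combination_apply, map_sum]
  refine Finset.sum_congr rfl fun k _ => ?_
  rw [map_smul, pullback_del]

theorem pullback_smul_apply {n : ℕ} (g : MultilinearMap ℂ (fun _ : Fin n => A)
    (MvPolynomial (Fin n) ℂ)) (w : Fin n → Fin 3) (v : Fin n → A) (t : ℂ)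
    (hv : ∀ i, τ t (v i) = t ^ (w i : ℕ) • v i) :
    (g fun i => τ t (v i)) = t ^ (∑ i, (w i : ℕ)) • g v := by
  simp only [hv]
  rw [g.map_smul_univ, Finset.prod_pow_eq_pow_sum]

/-- Both sides are multilinear, so weight vectors suffice. On total weight `W` the combination
multiplies by `1 / W` and the Lie derivative by `W`, which gives `1` for `W ≠ 0` and `0` for `W =
0`. This is `1 - 0 ^ W`, with `0 ^ 0 = 1`. The value `0⁻¹ = 0` prescribed in `hc` plays no role, as
it gets multiplied by `W = 0`. -/
theorem lieDerivative_combination (h : IsWeightElement N τ) {K : ℕ} {c : Fin K → ℂ} {n : ℕ}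
    (hc : ∀ w < 2 * n + 1, ∑ k : Fin K, c k * ((k : ℕ) : ℂ) ^ w = (w : ℂ)⁻¹)
    {γ : PreCochain A n} (hγ : γ ∈ cochains A n) :
    lieDerivative N n (combination τ c n γ) = γ - pullback (τ 0) n γ := by
  obtain ⟨⟨g, rfl⟩, -⟩ := hγ
  set g₀ : MultilinearMap ℂ (fun _ : Fin n => A) (MvPolynomial (Fin n) ℂ) :=
    ∑ k, c k • g.compLinearMap fun _ => (τ (k : ℕ)).restrictScalars ℂ
  have hg₀ : combination τ c n g = g₀ := by
    ext1 a
    simp [combination_apply, g₀, pullback_apply]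
  set D : A →ₗ[ℂ] A := (Finsupp.lapply 0).comp (bracket N)
  have hD : ∀ a, D a = bracket N a 0 := fun a => rfl
  set g₁ : MultilinearMap ℂ (fun _ : Fin n => A) (MvPolynomial (Fin n) ℂ) :=
    ∑ j, g₀.compLinearMap (Function.update (fun _ => LinearMap.id) j D)
  have hg₁ : lieDerivative N n g₀ = g₁ := by
    ext1 a
    simp only [lieDerivative, g₁, _root_.sum_apply, MultilinearMap.compLinearMap_apply]
    refine Finset.sum_congr rfl fun j _ => ?_
    congr 1
    ext1 i
    by_cases hi : i = j
    · subst hi; simp [hD]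
    · simp [hi]
  set g₂ : MultilinearMap ℂ (fun _ : Fin n => A) (MvPolynomial (Fin n) ℂ) :=
    g - g.compLinearMap fun _ => (τ 0).restrictScalars ℂ
  have key : g₁ = g₂ := by
    refine h.multilinear_ext fun v w hv hv' => ?_
    set W := ∑ i, (w i : ℕ)
    -- Each of the `n` weights is at most `2`, so `W` lies in the range controlled by `hc`.
    have hW : W < 2 * n + 1 := by
      have : W ≤ ∑ _i : Fin n, 2 := Finset.sum_le_sum fun i _ => by have := (w i).2; omega
      simp at this
      omega
    have e₀ : g₀ v = (W : ℂ)⁻¹ • g v := by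
      rw [← hc W hW, Finset.sum_smul]
      simp only [g₀, _root_.sum_apply, _root_.smul_apply, mul_smul]
      exact Finset.sum_congr rfl fun k _ => congrArg _
        (pullback_smul_apply g w v _ fun i => hv' i _)
    have e₁ : g₁ v = (W : ℂ) • g₀ v := by
      rw [← hg₁, lieDerivative, Nat.cast_sum, Finset.sum_smul]
      refine Finset.sum_congr rfl fun j _ => ?_
      rw [hv, g₀.map_update_smul, Function.update_eq_self]
    have e₂ : g₂ v = g v - (0 : ℂ) ^ W • g v :=
      congrArg (g v - ·) (pullback_smul_apply g w v _ fun i => hv' i _)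
    rw [e₁, e₀, e₂]
    by_cases hW0 : W = 0
    · simp [hW0]
    · rw [smul_smul, mul_inv_cancel₀ (Nat.cast_ne_zero.2 hW0), zero_pow hW0, zero_smul, one_smul,
        sub_zero]
  rw [hg₀, hg₁, key]
  rfl

/-- The pullback along `τ 0` is homotopic to the identity in positive degrees, the homotopies
commuting with `∂`. -/
theorem IsWeightElement.exists_homotopy (h : IsWeightElement N τ) (q : ℕ) :
    ∃ (s : PreCochain A (q + 1) →ₗ[ℂ] PreCochain A q)
      (s' : PreCochain A (q + 2) →ₗ[ℂ] PreCochain A (q + 1)),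
      (∀ γ ∈ cochains A (q + 1), s γ ∈ cochains A q) ∧
      (∀ γ ∈ cochains A (q + 2), s' γ ∈ cochains A (q + 1)) ∧
      (∀ γ, s' (del A (q + 2) γ) = del A (q + 1) (s' γ)) ∧
      ∀ γ ∈ cochains A (q + 1), γ - pullback (τ 0) (q + 1) γ
        = differential A q (s γ) + s' (differential A (q + 1) γ) := by
  -- The bound is dictated by degree `q + 1`. The same `c` serves in degree `q + 2`, where only
  -- compatibility with the differential is needed.
  obtain ⟨c, hc⟩ := exists_sum_mul_pow (2 * (q + 1) + 1) fun w => (w : ℂ)⁻¹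
  refine ⟨-(contract N q ∘ₗ combination τ c (q + 1)),
    -(contract N (q + 1) ∘ₗ combination τ c (q + 2)), fun γ hγ => ?_, fun γ hγ => ?_, fun γ => ?_,
    fun γ hγ => ?_⟩
  · rw [LinearMap.neg_apply, LinearMap.comp_apply]
    exact Submodule.neg_mem _ (contract_mem_cochains N (combination_mem_cochains c hγ))
  · rw [LinearMap.neg_apply, LinearMap.comp_apply]
    exact Submodule.neg_mem _ (contract_mem_cochains N (combination_mem_cochains c hγ))
  · simp only [LinearMap.neg_apply, LinearMap.comp_apply, combination_del, contract_del, map_neg]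
  · rw [← lieDerivative_combination h hc hγ]
    simp only [LinearMap.neg_apply, LinearMap.comp_apply, map_neg,
      ← differential_combination h c hγ]
    have hγ' := combination_mem_cochains (τ := τ) c hγ
    cases q with
    | zero =>
      rw [contract_differential_one N hγ']
      simp [differential]
    | succ m =>
      rw [← neg_add, add_comm (differential _ _ _), contract_differential N hγ', neg_neg]

theorem pullback_zero (f : A →ₗ[ℂ[X]] A) (γ : PreCochain A 0) : pullback f 0 γ = γ := by
  ext1 a
  rw [pullback_apply]
  congr 1
  exact Subsingleton.elim _ _

theorem IsWeightElement.sub_pullback_mem_basicCoboundaries (h : IsWeightElement N τ) {q : ℕ}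
    {γ : PreCochain A q} (hγ : γ ∈ basicCocycles A q) :
    γ - pullback (τ 0) q γ ∈ basicCoboundaries A q := by
  cases q with
  | zero =>
    rw [pullback_zero, sub_self]
    exact zero_mem _
  | succ q =>
    obtain ⟨s, s', hs, -, -, hst⟩ := h.exists_homotopy q
    rw [hst γ hγ.1, LinearMap.mem_ker.1 hγ.2, map_zero, add_zero]
    exact ⟨s γ, hs γ hγ.1, rfl⟩

/-- For a reduced cocycle `dγ = ∂φ`, so the second term of the homotopy formula is `s' (∂φ) = ∂ (s'
φ)`, which is zero in the reduced complex. -/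
theorem IsWeightElement.sub_pullback_mem_reducedCoboundaries (h : IsWeightElement N τ) {q : ℕ}
    {γ : PreCochain A q} (hγ : γ ∈ reducedCocycles A q) :
    γ - pullback (τ 0) q γ ∈ reducedCoboundaries A q := by
  cases q with
  | zero =>
    rw [pullback_zero, sub_self]
    exact zero_mem _
  | succ q =>
    obtain ⟨s, s', hs, hs', hdel, hst⟩ := h.exists_homotopy q
    obtain ⟨φ, hφ, hφγ⟩ := hγ.2
    rw [hst γ hγ.1, ← hφγ, hdel]
    exact Submodule.add_mem_sup ⟨s γ, hs γ hγ.1, rfl⟩ ⟨s' φ, hs' φ hφ, rfl⟩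

end Weights

end LieConformalAlgebra

-- The weight grading of the extended Schrödinger–Virasoro algebra and of its quotient

namespace ExtendedSV

open LieConformalAlgebra

/-- The eigenvalues of the zero mode of `N` on the generators. -/
def weight : Gen → Fin 3
  | .L | .N => 0
  | .Y => 1
  | .M => 2

/-- The endomorphism of `SV` acting by `tʷ` on the generators of weight `w`. -/
def scaling (t : ℂ) : SV →ₗ[ℂ[X]] SV :=
  LinearMap.pi fun z => (C (t ^ (weight z : ℕ))) • LinearMap.proj z

theorem scaling_apply (t : ℂ) (p : SV) (z : Gen) :
    scaling t p z = C (t ^ (weight z : ℕ)) * p z :=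
  rfl

theorem structureConst_eq_zero_or_weight_add (x y z : Gen) :
    structureConst x y z = 0 ∨ (weight x : ℕ) + (weight y : ℕ) = (weight z : ℕ) := by
  cases x <;> cases y <;> cases z <;> first | exact Or.inr (by decide) | exact Or.inl rfl

theorem structureConst_scaling (t : ℂ) (x y z : Gen) :
    C (C (t ^ (weight x : ℕ))) * C (C (t ^ (weight y : ℕ))) * structureConst x y z
      = C (C (t ^ (weight z : ℕ))) * structureConst x y z := by
  rcases structureConst_eq_zero_or_weight_add x y z with h | h
  · rw [h, mul_zero, mul_zero]
  · rw [← C_mul, ← C_mul, ← pow_add, h]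

/-- A nonzero structure constant forces the weights to add, so both sides carry the same power of
`t`. No division by `t` occurs, hence `t = 0` is allowed. -/
theorem isHom_scaling (t : ℂ) : IsHom (scaling t) := by
  intro p q
  refine Finsupp.ext fun n => funext fun z => ?_
  change svBracket (scaling t p) (scaling t q) n z = scaling t (svBracket p q n) z
  rw [scaling_apply, svBracket_apply, svBracket_apply, Finset.mul_sum]
  refine Finset.sum_congr rfl fun x _ => ?_
  rw [Finset.mul_sum]
  refine Finset.sum_congr rfl fun y _ => ?_
  rw [← coeff_C_mul]
  congr 1
  have ha : ∀ (a : ℂ) (f : ℂ[X]) (s : ℂ[X][X]), aeval s (C a * f) = C (C a) * aeval s f := by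
    intro a f s
    rw [map_mul, aeval_C]
    rfl
  rw [scaling_apply, scaling_apply, ha, ha]
  linear_combination (aeval (-X : ℂ[X][X]) (p x) * aeval (C X + X : ℂ[X][X]) (q y))
    * structureConst_scaling t x y z

/-- The only bracket of `N` with a generator that changes the generator is `[N_λ L] = λN`, and it
vanishes at `λ = 0`. The zero mode is thus diagonal and commutes with `∂`. -/
theorem svBracket_N_apply_zero (p : SV) (z : Gen) :
    svBracket (Pi.single .N 1) p 0 z = ((weight z : ℕ) : ℂ) • p z := by
  rw [svBracket_apply, Finset.sum_eq_single .N]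
  · simp only [Pi.single_eq_same, map_one, one_mul, coeff_zero_eq_eval_zero, eval_mul,
      eval_aeval, sum_gen]
    cases z <;> simp [structureConst, weight, two_smul, mul_two]
  · intro x _ hx
    simp [Pi.single_eq_of_ne hx]
  · simp

theorem isWeightElement_N : IsWeightElement (A := SV) (Pi.single .N 1) scaling where
  isHom := isHom_scaling
  exists_decomposition p := by
    refine ⟨fun w z => if weight z = w then p z else 0, ?_, fun w => ⟨?_, fun t => ?_⟩⟩
    · ext1 z
      simp
    · ext1 z
      change svBracket _ _ 0 z = _
      rw [svBracket_N_apply_zero]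
      by_cases hz : weight z = w
      · simp [hz]
      · simp [hz]
    · ext1 z
      rw [scaling_apply]
      by_cases hz : weight z = w
      · simp [hz, smul_eq_C_mul]
      · simp [hz]

/-- The projection `SV → SV/⟨M⟩`. -/
abbrev projM : SV →ₗ[ℂ[X]] SVModM := spanM.mkQ

theorem isHom_projM : IsHom projM := by
  intro p q
  exact quotientBracket_proj spanM isIdeal_spanM p q

/-- Brackets in the quotient are computed on representatives, as `projM` is a surjective
homomorphism. -/
theorem isHom_of_comp_projM {B : Type*} [AddCommGroup B] [Module ℂ B] [Module ℂ[X] B]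
    [IsScalarTower ℂ ℂ[X] B] [LieConformalAlgebra B] {f : SVModM →ₗ[ℂ[X]] B}
    (hf : IsHom (f ∘ₗ projM)) : IsHom f := by
  intro x y
  obtain ⟨p, rfl⟩ := spanM.mkQ_surjective x
  obtain ⟨q, rfl⟩ := spanM.mkQ_surjective y
  rw [isHom_projM p q]
  refine (hf p q).trans ?_
  ext n
  rfl

theorem isHom_projM_comp {f : SV →ₗ[ℂ[X]] SV} (hf : IsHom f) : IsHom (projM ∘ₗ f) := by
  intro p q
  rw [LinearMap.comp_apply, LinearMap.comp_apply, isHom_projM, hf]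
  ext n
  rfl

/-- The endomorphism of `SV/⟨M⟩` induced by `scaling t`. -/
def scalingModM (t : ℂ) : SVModM →ₗ[ℂ[X]] SVModM :=
  spanM.mapQ spanM (scaling t) fun p hp => by
    obtain ⟨h1, h2, h3⟩ := mem_spanM.1 hp
    refine mem_spanM.2 ⟨?_, ?_, ?_⟩ <;> simp [scaling_apply, h1, h2, h3]

theorem scalingModM_projM (t : ℂ) (p : SV) : scalingModM t (projM p) = projM (scaling t p) :=
  rfl

/-- A weight decomposition in `SV` projects to one in the quotient. -/
theorem isWeightElement_projM_N :
    IsWeightElement (A := SVModM) (projM (Pi.single .N 1)) scalingModM where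
  isHom t := isHom_of_comp_projM (isHom_projM_comp (isHom_scaling t))
  exists_decomposition x := by
    obtain ⟨p, rfl⟩ := spanM.mkQ_surjective x
    obtain ⟨f, hf, hf'⟩ := isWeightElement_N.exists_decomposition p
    refine ⟨fun w => projM (f w), ?_, fun w => ⟨?_, fun t => ?_⟩⟩
    · rw [← map_sum, ← hf]
    · rw [isHom_projM, Finsupp.mapRange_apply, (hf' w).1, LinearMap.map_smul_of_tower]
    · rw [scalingModM_projM, (hf' w).2, LinearMap.map_smul_of_tower]

/-- The homomorphism `SV/⟨M⟩ → SV` that fixes `L`, `N` and kills `Y`. -/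
def liftModM : SVModM →ₗ[ℂ[X]] SV :=
  spanM.liftQ (scaling 0) fun p hp => by
    obtain ⟨h1, h2, h3⟩ := mem_spanM.1 hp
    ext1 z
    cases z <;> simp [scaling_apply, h1, h2, h3, weight]

theorem isHom_liftModM : IsHom liftModM := isHom_of_comp_projM (isHom_scaling 0)

theorem pullback_projM_liftModM (n : ℕ) (γ : PreCochain SV n) :
    pullback projM n (pullback liftModM n γ) = pullback (scaling 0) n γ :=
  rfl

/-- Unlike the opposite composite, this one needs representatives of the arguments before the two
maps agree by definition. -/
theorem pullback_liftModM_projM (n : ℕ) (γ : PreCochain SVModM n) :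
    pullback liftModM n (pullback projM n γ) = pullback (scalingModM 0) n γ := by
  ext1 a
  rw [pullback_apply, pullback_apply, pullback_apply]
  congr 1
  ext1 i
  obtain ⟨p, hp⟩ := spanM.mkQ_surjective (a i)
  rw [← hp]
  rfl

/-- The coefficients of `L`, `N` and `Y` identify `SV/⟨M⟩` with `ℂ[∂]³`. -/
def equivModM : SVModM ≃ₗ[ℂ[X]] (Fin 3 → ℂ[X]) :=
  let f : SV →ₗ[ℂ[X]] (Fin 3 → ℂ[X]) :=
    LinearMap.funLeft ℂ[X] ℂ[X] (![.L, .N, .Y] : Fin 3 → Gen)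
  have hker : spanM = LinearMap.ker f := by
    ext p
    rw [mem_spanM, LinearMap.mem_ker, funext_iff, Fin.forall_fin_succ, Fin.forall_fin_succ,
      Fin.forall_fin_succ]
    simp [f, LinearMap.funLeft_apply]
  have hf : Function.Surjective f := LinearMap.funLeft_surjective_of_injective _ _ _ (by decide)
  (Submodule.quotEquivOfEq _ _ hker).trans (f.quotKerEquivOfSurjective hf)

end ExtendedSV

end

-- The comparison of cohomologies

open ExtendedSV LieConformalAlgebra in
theorem mainTheorem11 :
    (Module.Free ℂ[X] ExtendedSV.SVModM ∧ Module.finrank ℂ[X] ExtendedSV.SVModM = 3) ∧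
    ∀ q : ℕ,
      (∃ e : LieConformalAlgebra.BasicCohomology ExtendedSV.SVModM q ≃ₗ[ℂ]
          LieConformalAlgebra.BasicCohomology ExtendedSV.SV q,
        ∀ x, e (LieConformalAlgebra.BasicCohomology.del ExtendedSV.SVModM q x)
          = LieConformalAlgebra.BasicCohomology.del ExtendedSV.SV q (e x)) ∧
      Nonempty (LieConformalAlgebra.ReducedCohomology ExtendedSV.SVModM q ≃ₗ[ℂ]
        LieConformalAlgebra.ReducedCohomology ExtendedSV.SV q) := by
  refine ⟨⟨Module.Free.of_equiv equivModM.symm, ?_⟩, fun q => ⟨?_, ?_⟩⟩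
  · rw [equivModM.finrank_eq, Module.finrank_fin_fun]
  · obtain ⟨e, he⟩ := exists_subquotientEquiv (pullback projM q) (pullback liftModM q)
      (fun γ hγ => pullback_mem_basicCocycles isHom_projM hγ)
      (fun γ hγ => pullback_mem_basicCoboundaries isHom_projM hγ)
      (fun γ hγ => pullback_mem_basicCocycles isHom_liftModM hγ)
      (fun γ hγ => pullback_mem_basicCoboundaries isHom_liftModM hγ)
      (fun γ hγ => by
        rw [pullback_liftModM_projM]
        exact isWeightElement_projM_N.sub_pullback_mem_basicCoboundaries hγ)
      (fun γ hγ => by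
        rw [pullback_projM_liftModM]
        exact isWeightElement_N.sub_pullback_mem_basicCoboundaries hγ)
    refine ⟨e, fun x => ?_⟩
    obtain ⟨γ, rfl⟩ := Submodule.Quotient.mk_surjective _ x
    -- The isomorphism is induced by the pullback, which commutes with multiplication by the sum of
    -- the variables by definition; so both sides are the class of the same cochain.
    rw [he]
    exact he _
  · obtain ⟨e, -⟩ := exists_subquotientEquiv (pullback projM q) (pullback liftModM q)
      (fun γ hγ => pullback_mem_reducedCocycles isHom_projM hγ)
      (fun γ hγ => pullback_mem_reducedCoboundaries isHom_projM hγ)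
      (fun γ hγ => pullback_mem_reducedCocycles isHom_liftModM hγ)
      (fun γ hγ => pullback_mem_reducedCoboundaries isHom_liftModM hγ)
      (fun γ hγ => by
        rw [pullback_liftModM_projM]
        exact isWeightElement_projM_N.sub_pullback_mem_reducedCoboundaries hγ)
      (fun γ hγ => by
        rw [pullback_projM_liftModM]
        exact isWeightElement_N.sub_pullback_mem_reducedCoboundaries hγ)
    exact ⟨e⟩
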